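/- Let $n\ge 2$, let $\mathcal N$ be the real vector space of skew-Hermitian matrices $X\in\mathbb C^{n\times n}$, $X^*=-X$, viewed as a real manifold, and let $\mathcal M\subset\mathcal N$ be the set of derogatory skew-Hermitian matrices, i.e. those having an eigenvalue of geometric multiplicity greater than $1$. Then $\dim_{\mathbb R}\mathcal N=n^2$ and $\mathcal M$ has real codimension $3$ in $\mathcal N$, in the following precise sense. Let $\mathcal M_0\subset\mathcal M$ be the set of matrices in $\mathcal M$ with exactly one multiple eigenvalue, that eigenvalue having multiplicity exactly $2$. Then $\mathcal M_0$ is a nonempty embedded smooth submanifold of $\mathcal N$ of real codimension $\dim\mathcal N-\dim\mathcal M_0=3$; it is relatively open and dense in $\mathcal M$; and $\mathcal M\setminus\mathcal M_0$ is a finite (possibly empty) disjoint union of nonempty embedded smooth submanifolds of $\mathcal N$, each of real codimension strictly greater than $3$. -/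

import Mathlib

open scoped ContDiff

-- The Frobenius norm; any norm induces the same topology and the same smooth maps.
attribute [local instance] Matrix.frobeniusNormedAddCommGroup Matrix.frobeniusNormedSpace

/-- The real vector space (hence real manifold) of complex `n × n` matrices `X` with `X* = -X`. -/
noncomputable abbrev SkewHermitian (n : ℕ) : Submodule ℝ (Matrix (Fin n) (Fin n) ℂ) :=
  skewAdjoint.submodule ℝ (Matrix (Fin n) (Fin n) ℂ)

/-- The geometric multiplicity of `μ` as an eigenvalue of `A` (zero if `μ` is no eigenvalue). -/
noncomputable def geomMult {n : ℕ} (A : Matrix (Fin n) (Fin n) ℂ) (μ : ℂ) : ℕ :=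
  Module.finrank ℂ (Module.End.eigenspace (Matrix.toLin' A) μ)

/-- The derogatory skew-Hermitian matrices: some eigenvalue has geometric multiplicity
greater than one. -/
def derogatorySkewHermitian (n : ℕ) : Set (SkewHermitian n) :=
  {A | ∃ μ : ℂ, 1 < geomMult (A : Matrix (Fin n) (Fin n) ℂ) μ}

/-- The skew-Hermitian matrices with exactly one multiple eigenvalue, of multiplicity two. -/
def oneDoubleSkewHermitian (n : ℕ) : Set (SkewHermitian n) :=
  {A | ∃ μ : ℂ, geomMult (A : Matrix (Fin n) (Fin n) ℂ) μ = 2 ∧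
    ∀ ν : ℂ, ν ≠ μ → geomMult (A : Matrix (Fin n) (Fin n) ℂ) ν ≤ 1}

/-- `M` is an embedded smooth submanifold of dimension `d` of the real vector space `E`: around
each of its points there is a smooth chart of `E` (a diffeomorphism between open subsets of `E`)
that carries `M` to a `d`-dimensional linear subspace. -/
def IsSmoothSubmanifold {E : Type*} [NormedAddCommGroup E] [NormedSpace ℝ E]
    (d : ℕ) (M : Set E) : Prop :=
  ∀ x ∈ M, ∃ (φ : OpenPartialHomeomorph E E) (W : Submodule ℝ E),
    x ∈ φ.source ∧ ContDiffOn ℝ ∞ φ φ.source ∧ ContDiffOn ℝ ∞ φ.symm φ.target ∧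
    Module.finrank ℝ W = d ∧ ∀ y ∈ φ.source, (y ∈ M ↔ φ y ∈ W)

/-- `M` is a nonempty embedded smooth submanifold of `E` with `dim E - dim M = c`. -/
def IsSubmanifoldOfCodim {E : Type*} [NormedAddCommGroup E] [NormedSpace ℝ E]
    (c : ℕ) (M : Set E) : Prop :=
  M.Nonempty ∧ ∃ d : ℕ, IsSmoothSubmanifold d M ∧ d + c = Module.finrank ℝ E

/-!
Let `c(A) = ∑ (m(μ) ^ 2 - 1)`, summed over the eigenvalues `μ` of `A` with multiplicities `m(μ)`.
Then `A` is derogatory exactly when `c(A) ≥ 3`, and it has one double and otherwise simple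
eigenvalues exactly when `c(A) = 3`, so everything reduces to the level sets of `c`.

Write `A = U D U*` with `D` diagonal, and let `π` be the projection onto the block-diagonal matrices
for the eigenspaces of `D`. The map `X ↦ V (D + π X) V*` with `V = U exp (X - π X)` is a local
diffeomorphism at `0`, since its derivative there is `U (π X + [X - π X, D]) U*` and `[·, D]` is
injective off the blocks; as `c` is invariant under unitary conjugation, it equals `c(D + π X)` in
these coordinates. Now `D + π X` commutes with `D`, so each of its eigenspaces lies in an eigenspace
of `D` when `X` is small: the eigenvalues of `D` can only split. Hence `c(D + π X) ≤ c(D)`, with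
equality exactly when `π X` is scalar on each block, which is a linear condition on `X` of
codimension `c(D)`. Thus the level sets of `c` are submanifolds of codimension `c`, and `c` is upper
semicontinuous. For the density, move the diagonal entries of `D` apart along a line, keeping two
coincident ones equal.
-/

open scoped Finset

theorem exists_smooth_chart_of_hasFDerivAt_equiv {𝕜 E : Type*} [RCLike 𝕜] [NormedAddCommGroup E]
    [NormedSpace 𝕜 E] [CompleteSpace E] {m : WithTop ℕ∞} (hm : m ≠ 0) {Φ : E → E}
    (hΦ : ContDiff 𝕜 m Φ) {e : E ≃L[𝕜] E} {a : E} (he : HasFDerivAt Φ (e : E →L[𝕜] E) a)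
    {N : Set E} (hN : N ∈ nhds a) :
    ∃ φ : OpenPartialHomeomorph E E, Φ a ∈ φ.source ∧ ContDiffOn 𝕜 m φ φ.source ∧
      ContDiffOn 𝕜 m φ.symm φ.target ∧ ∀ y ∈ φ.source, φ y ∈ N ∧ Φ (φ y) = y := by
  -- The local inverse is smooth only where the derivative of `Φ` stays invertible.
  set V : Set E := {x | fderiv 𝕜 Φ x ∈ Set.range ((↑) : (E ≃L[𝕜] E) → E →L[𝕜] E)} ∩ interior N
  have hV : IsOpen V :=
    (ContinuousLinearEquiv.isOpen.preimage (hΦ.continuous_fderiv hm)).inter isOpen_interior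
  set ψ : OpenPartialHomeomorph E E :=
    (hΦ.contDiffAt.toOpenPartialHomeomorph Φ he hm).restrOpen V hV
  have hsource : ψ.source ⊆ V := Set.inter_subset_right
  have ha : a ∈ ψ.source := ⟨hΦ.contDiffAt.mem_toOpenPartialHomeomorph_source he hm,
    ⟨e, he.fderiv.symm⟩, mem_interior_iff_mem_nhds.2 hN⟩
  refine ⟨ψ.symm, ψ.map_source ha, fun y hy => ?_, hΦ.contDiffOn,
    fun y hy => ⟨interior_subset (hsource (ψ.map_target hy)).2, ψ.right_inv hy⟩⟩
  obtain ⟨e', he'⟩ := (hsource (ψ.map_target hy)).1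
  refine (ψ.contDiffAt_symm (f₀' := e') hy ?_ hΦ.contDiffAt).contDiffWithinAt
  rw [he']
  exact (hΦ.differentiable hm _).hasFDerivAt

theorem exists_fin_partition_preimage_singleton {X Y : Type*} (f : X → Y) {t : Set Y}
    (hfin : (f '' (f ⁻¹' t)).Finite) :
    ∃ (k : ℕ) (S : Fin k → Set X), f ⁻¹' t = ⋃ i, S i ∧ Pairwise (Function.onFun Disjoint S) ∧
      ∀ i, ∃ x, f x ∈ t ∧ S i = f ⁻¹' {f x} := by
  have := hfin.to_subtype
  let e := (Finite.equivFin (f '' (f ⁻¹' t))).symm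
  refine ⟨Nat.card (f '' (f ⁻¹' t)), fun i => f ⁻¹' {(e i : Y)}, ?_, fun i j hij => ?_, fun i => ?_⟩
  · ext x
    simp only [Set.mem_iUnion, Set.mem_preimage, Set.mem_singleton_iff]
    constructor
    · exact fun hx => ⟨e.symm ⟨f x, x, hx, rfl⟩, by rw [e.apply_symm_apply]⟩
    · rintro ⟨i, hi⟩
      obtain ⟨z, hz, hzi⟩ := (e i).2
      rwa [hi, ← hzi]
  · exact Disjoint.preimage f
      (Set.disjoint_singleton.2 fun h => hij (e.injective (Subtype.ext h)))
  · obtain ⟨z, hz, hzi⟩ := (e i).2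
    exact ⟨z, hz, by rw [hzi]⟩

section SkewAdjointDecomposition

variable {A : Type*} [AddCommGroup A] [Module ℂ A] [StarAddMonoid A] [StarModule ℂ A]

theorem eq_zero_of_mem_skewAdjoint_of_add_I_smul_eq_zero {x y : A} (hx : x ∈ skewAdjoint A)
    (hy : y ∈ skewAdjoint A) (h : x + Complex.I • y = 0) : x = 0 ∧ y = 0 := by
  rw [skewAdjoint.mem_iff] at hx hy
  have hstar : -x + Complex.I • y = 0 := by
    simpa [star_smul, hx, hy] using congrArg star h
  have hx0 : x = 0 := by
    have hneg : x = -x := add_right_cancel (h.trans hstar.symm)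
    rw [eq_neg_iff_add_eq_zero, ← two_smul ℂ] at hneg
    exact (smul_eq_zero_iff_right two_ne_zero).1 hneg
  exact ⟨hx0, by simpa [hx0] using h⟩

theorem exists_mem_skewAdjoint_add_I_smul_eq {V : Submodule ℂ A} (hV : ∀ x ∈ V, star x ∈ V)
    {z : A} (hz : z ∈ V) :
    ∃ x ∈ V, x ∈ skewAdjoint A ∧ ∃ y ∈ V, y ∈ skewAdjoint A ∧ x + Complex.I • y = z := by
  refine ⟨(2⁻¹ : ℂ) • (z - star z), V.smul_mem _ (V.sub_mem hz (hV z hz)), ?_,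
    -(2⁻¹ * Complex.I) • (z + star z), V.smul_mem _ (V.add_mem hz (hV z hz)), ?_, ?_⟩
  · rw [skewAdjoint.mem_iff]
    simp [star_smul, ← smul_neg]
  · rw [skewAdjoint.mem_iff]
    simp [star_smul, add_comm]
  · have hI : Complex.I * -(2⁻¹ * Complex.I) = 2⁻¹ := by
      linear_combination -2⁻¹ * Complex.I_mul_I
    rw [smul_smul, hI]
    module

theorem finrank_comap_skewAdjoint_subtype [FiniteDimensional ℂ A] {V : Submodule ℂ A}
    (hV : ∀ x ∈ V, star x ∈ V) :
    Module.finrank ℝ ((V.restrictScalars ℝ).comap (skewAdjoint.submodule ℝ A).subtype) =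
      Module.finrank ℂ V := by
  set W := (V.restrictScalars ℝ).comap (skewAdjoint.submodule ℝ A).subtype
  let toV : W →ₗ[ℝ] V :=
    ((skewAdjoint.submodule ℝ A).subtype.domRestrict W).codRestrict (V.restrictScalars ℝ)
      fun w => w.2
  let decomposition : (W × W) →ₗ[ℝ] V :=
    toV.coprod ((LinearMap.lsmul ℂ V Complex.I).restrictScalars ℝ ∘ₗ toV)
  have hinj : Function.Injective decomposition := by
    refine (injective_iff_map_eq_zero _).2 fun p hp => ?_
    obtain ⟨hfst, hsnd⟩ := eq_zero_of_mem_skewAdjoint_of_add_I_smul_eq_zero p.1.1.2 p.2.1.2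
      (congrArg Subtype.val hp)
    exact Prod.ext (Subtype.ext (Subtype.ext hfst)) (Subtype.ext (Subtype.ext hsnd))
  have hsurj : Function.Surjective decomposition := by
    intro z
    obtain ⟨x, hxV, hx, y, hyV, hy, hxy⟩ := exists_mem_skewAdjoint_add_I_smul_eq hV z.2
    exact ⟨(⟨⟨x, hx⟩, hxV⟩, ⟨⟨y, hy⟩, hyV⟩), Subtype.ext hxy⟩
  have hreal := (LinearEquiv.ofBijective decomposition ⟨hinj, hsurj⟩).finrank_eq
  rw [Module.finrank_prod, finrank_real_of_complex] at hreal
  omega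

end SkewAdjointDecomposition

theorem finrank_skewHermitian (n : ℕ) : Module.finrank ℝ (SkewHermitian n) = n ^ 2 := by
  have h := finrank_comap_skewAdjoint_subtype (A := Matrix (Fin n) (Fin n) ℂ) (V := ⊤)
    fun _ _ => Submodule.mem_top
  rw [Submodule.restrictScalars_top, Submodule.comap_top, finrank_top, finrank_top,
    Module.finrank_matrix] at h
  rw [h]
  simp [sq]

theorem add_le_finsum_of_ne {α : Type*} {f : α → ℕ} (hf : f.HasFiniteSupport) {a b : α}
    (hab : a ≠ b) : f a + f b ≤ ∑ᶠ x, f x := by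
  classical
  rw [finsum_eq_sum_of_support_subset (s := Set.Finite.toFinset hf ∪ {a, b}) f
    fun x hx => by
      simpa using .inr (.inr ((Set.Finite.mem_toFinset hf).2 hx))]
  exact Finset.add_le_sum (fun _ _ => zero_le) (by simp) (by simp) hab

theorem three_le_sq_sub_one {k : ℕ} (hk : 1 < k) : 3 ≤ k ^ 2 - 1 :=
  Nat.le_sub_of_add_le (Nat.pow_le_pow_left hk 2)

theorem sq_sub_one_eq_zero {k : ℕ} (hk : k ≤ 1) : k ^ 2 - 1 = 0 :=
  Nat.sub_eq_zero_of_le (pow_le_one₀ zero_le hk)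

section Multiplicities

variable {α : Type*} {m : α → ℕ}

theorem hasFiniteSupport_sq_sub_one (hm : m.HasFiniteSupport) :
    (fun a => m a ^ 2 - 1).HasFiniteSupport :=
  Set.Finite.subset hm fun _ ha h => ha (sq_sub_one_eq_zero (h.trans_le zero_le_one))

theorem three_le_finsum_sq_sub_one_iff (hm : m.HasFiniteSupport) :
    3 ≤ ∑ᶠ a, (m a ^ 2 - 1) ↔ ∃ a, 1 < m a := by
  constructor
  · contrapose!
    intro h
    rw [finsum_eq_zero_of_forall_eq_zero fun a => sq_sub_one_eq_zero (h a)]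
    exact three_pos
  · rintro ⟨a, ha⟩
    exact (three_le_sq_sub_one ha).trans
      (single_le_finsum a (hasFiniteSupport_sq_sub_one hm) fun _ => zero_le)

theorem finsum_sq_sub_one_eq_three_iff (hm : m.HasFiniteSupport) :
    ∑ᶠ a, (m a ^ 2 - 1) = 3 ↔ ∃ a, m a = 2 ∧ ∀ b, b ≠ a → m b ≤ 1 := by
  constructor
  · intro h
    obtain ⟨a, ha⟩ := (three_le_finsum_sq_sub_one_iff hm).1 h.ge
    have hle : m a ^ 2 - 1 ≤ 3 :=
      h ▸ single_le_finsum a (hasFiniteSupport_sq_sub_one hm) fun _ => zero_le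
    refine ⟨a, le_antisymm ?_ ha, fun b hb => ?_⟩
    · exact (Nat.pow_le_pow_iff_left (n := 2) two_ne_zero).1 (by omega)
    · by_contra! hb1
      have hadd := add_le_finsum_of_ne (hasFiniteSupport_sq_sub_one hm) hb
      have := three_le_sq_sub_one ha
      have := three_le_sq_sub_one hb1
      omega
  · rintro ⟨a, ha, hb⟩
    rw [finsum_eq_single _ a fun b hba => sq_sub_one_eq_zero (hb b hba), ha]
    norm_num

end Multiplicities

section Fibres

variable {ι α β : Type*} [Fintype ι] [DecidableEq α] [DecidableEq β]

theorem card_filter_eq_le_comp (f : ι → α) (g : α → β) :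
    #{p : ι × ι | f p.1 = f p.2} ≤ #{p : ι × ι | (g ∘ f) p.1 = (g ∘ f) p.2} :=
  Finset.card_le_card (Finset.monotone_filter_right _ fun _ _ h => congrArg g h)

theorem card_image_comp_le (f : ι → α) (g : α → β) :
    #(Finset.univ.image (g ∘ f)) ≤ #(Finset.univ.image f) := by
  rw [← Finset.image_image]
  exact Finset.card_image_le

theorem card_image_comp_eq_iff (f : ι → α) (g : α → β) :
    #(Finset.univ.image (g ∘ f)) = #(Finset.univ.image f) ↔ Set.InjOn g (Set.range f) := by
  rw [← Finset.image_image, Finset.card_image_iff, Finset.coe_image, Finset.coe_univ,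
    Set.image_univ]

theorem sum_sq_card_fibre (f : ι → α) :
    ∑ a ∈ Finset.univ.image f, #{i | f i = a} ^ 2 =
      #{p : ι × ι | f p.1 = f p.2} := by
  rw [Finset.card_eq_sum_card_fiberwise (f := fun p : ι × ι => f p.1)
    (t := Finset.univ.image f) fun p _ => Finset.mem_image_of_mem f (Finset.mem_univ p.1)]
  refine Finset.sum_congr rfl fun a _ => ?_
  rw [sq, ← Finset.card_product]
  congr 1
  ext p
  simp only [Finset.mem_product, Finset.mem_filter, Finset.mem_univ, true_and]
  constructor
  · rintro ⟨h₁, h₂⟩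
    exact ⟨h₁.trans h₂.symm, h₁⟩
  · rintro ⟨h, h₁⟩
    exact ⟨h₁, h.symm.trans h₁⟩

theorem finsum_sq_card_fibre_sub_one_add_card_image (f : ι → α) :
    ∑ᶠ a, (#{i | f i = a} ^ 2 - 1) + #(Finset.univ.image f) =
      #{p : ι × ι | f p.1 = f p.2} := by
  have hpos {a : α} (ha : a ∈ Finset.univ.image f) :
      1 ≤ #{i | f i = a} ^ 2 := by
    obtain ⟨i, -, hi⟩ := Finset.mem_image.1 ha
    exact Nat.one_le_pow _ _ (Finset.card_pos.2 ⟨i, by simpa using hi⟩)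
  have hsupp : (fun a => #{i | f i = a} ^ 2 - 1).support ⊆
      Finset.univ.image f := by
    intro a ha
    by_contra hnot
    refine ha (sq_sub_one_eq_zero ?_)
    rw [Finset.filter_false_of_mem fun i hi hia => hnot (Finset.mem_image.2 ⟨i, hi, hia⟩)]
    exact zero_le_one
  rw [finsum_eq_sum_of_support_subset _ hsupp, ← sum_sq_card_fibre, Finset.card_eq_sum_ones,
    ← Finset.sum_add_distrib]
  exact Finset.sum_congr rfl fun a ha => Nat.sub_add_cancel (hpos ha)

end Fibres

section GeometricMultiplicity

variable {n : ℕ}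

theorem geomMult_add_rank_sub_smul_one (A : Matrix (Fin n) (Fin n) ℂ) (μ : ℂ) :
    geomMult A μ + (A - μ • 1).rank = n := by
  have h : Matrix.toLin' A - μ • 1 = Matrix.toLin' (A - μ • 1) := by
    rw [map_sub, map_smul, Matrix.toLin'_one]
    rfl
  rw [geomMult, Module.End.eigenspace_def, h, Matrix.rank, ← Matrix.toLin'_apply', add_comm,
    LinearMap.finrank_range_add_finrank_ker, Module.finrank_fin_fun]

theorem geomMult_conjStarAlgAut (U : unitary (Matrix (Fin n) (Fin n) ℂ))
    (A : Matrix (Fin n) (Fin n) ℂ) (μ : ℂ) :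
    geomMult (Unitary.conjStarAlgAut ℂ _ U A) μ = geomMult A μ := by
  have hU : IsUnit (U : Matrix (Fin n) (Fin n) ℂ).det :=
    (Matrix.isUnit_iff_isUnit_det _).1 (Unitary.toUnits U).isUnit
  have hU' : IsUnit (star (U : Matrix (Fin n) (Fin n) ℂ)).det :=
    (Matrix.isUnit_iff_isUnit_det _).1 (Unitary.toUnits (star U)).isUnit
  have hrank : (Unitary.conjStarAlgAut ℂ _ U A - μ • 1).rank = (A - μ • 1).rank := by
    have h : Unitary.conjStarAlgAut ℂ _ U A - μ • 1 =
        Unitary.conjStarAlgAut ℂ _ U (A - μ • 1) := by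
      rw [map_sub, map_smul, map_one]
    rw [h, Unitary.conjStarAlgAut_apply, Matrix.rank_mul_eq_left_of_isUnit_det _ _ hU',
      Matrix.rank_mul_eq_right_of_isUnit_det _ _ hU]
  refine Nat.add_right_cancel (m := (A - μ • 1).rank) ?_
  rw [geomMult_add_rank_sub_smul_one, ← hrank, geomMult_add_rank_sub_smul_one]

theorem geomMult_diagonal (d : Fin n → ℂ) (μ : ℂ) :
    geomMult (Matrix.diagonal d) μ = #{j | d j = μ} := by
  have h := geomMult_add_rank_sub_smul_one (Matrix.diagonal d) μ
  rw [Matrix.smul_one_eq_diagonal, Matrix.diagonal_sub, Matrix.rank_diagonal,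
    Fintype.card_subtype] at h
  simp only [ne_eq, sub_eq_zero] at h
  have hcard := Finset.card_filter_add_card_filter_not (s := Finset.univ) fun j => d j = μ
  rw [Finset.card_univ, Fintype.card_fin] at hcard
  omega

theorem hasFiniteSupport_geomMult (A : Matrix (Fin n) (Fin n) ℂ) :
    (geomMult A).HasFiniteSupport :=
  (Module.End.finite_hasEigenvalue (Matrix.toLin' A)).subset fun _ hμ h =>
    hμ (Submodule.finrank_eq_zero.2 h)

/-- The codimension of the stratum of skew-Hermitian matrices through `A`: a commutant of dimension
`∑ m(μ) ^ 2` is traded for one real parameter per eigenvalue `μ`. Since the subtraction is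
truncated, complex numbers which are not eigenvalues contribute `0`. -/
noncomputable def multiplicityCodim (A : Matrix (Fin n) (Fin n) ℂ) : ℕ :=
  ∑ᶠ μ, (geomMult A μ ^ 2 - 1)

theorem multiplicityCodim_conjStarAlgAut (U : unitary (Matrix (Fin n) (Fin n) ℂ))
    (A : Matrix (Fin n) (Fin n) ℂ) :
    multiplicityCodim (Unitary.conjStarAlgAut ℂ _ U A) = multiplicityCodim A := by
  simp only [multiplicityCodim, geomMult_conjStarAlgAut]

theorem multiplicityCodim_diagonal_add_card_image (d : Fin n → ℂ) :
    multiplicityCodim (Matrix.diagonal d) + #(Finset.univ.image d) =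
      #{p : Fin n × Fin n | d p.1 = d p.2} := by
  simp only [multiplicityCodim, geomMult_diagonal]
  exact finsum_sq_card_fibre_sub_one_add_card_image d

theorem derogatorySkewHermitian_eq_setOf :
    derogatorySkewHermitian n =
      {A : SkewHermitian n | 3 ≤ multiplicityCodim (A : Matrix (Fin n) (Fin n) ℂ)} :=
  Set.ext fun _ => (three_le_finsum_sq_sub_one_iff (hasFiniteSupport_geomMult _)).symm

theorem oneDoubleSkewHermitian_eq_setOf :
    oneDoubleSkewHermitian n =
      {A : SkewHermitian n | multiplicityCodim (A : Matrix (Fin n) (Fin n) ℂ) = 3} :=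
  Set.ext fun _ => (finsum_sq_sub_one_eq_three_iff (hasFiniteSupport_geomMult _)).symm

theorem multiplicityCodim_diagonal_le_comp (b : Fin n → ℂ) (f : ℂ → ℂ) :
    multiplicityCodim (Matrix.diagonal b) ≤ multiplicityCodim (Matrix.diagonal (f ∘ b)) := by
  have hb := multiplicityCodim_diagonal_add_card_image b
  have hfb := multiplicityCodim_diagonal_add_card_image (f ∘ b)
  have himage := card_image_comp_le b f
  have hpairs := card_filter_eq_le_comp b f
  omega

theorem multiplicityCodim_diagonal_eq_comp_iff (b : Fin n → ℂ) (f : ℂ → ℂ) :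
    multiplicityCodim (Matrix.diagonal b) = multiplicityCodim (Matrix.diagonal (f ∘ b)) ↔
      Set.InjOn f (Set.range b) := by
  have hb := multiplicityCodim_diagonal_add_card_image b
  have hfb := multiplicityCodim_diagonal_add_card_image (f ∘ b)
  have himage := card_image_comp_le b f
  have hpairs := card_filter_eq_le_comp b f
  rw [← card_image_comp_eq_iff]
  refine ⟨fun h => by omega, fun h => ?_⟩
  have hpairs_eq : #{p : Fin n × Fin n | (f ∘ b) p.1 = (f ∘ b) p.2} =
      #{p : Fin n × Fin n | b p.1 = b p.2} := by
    simp only [Function.comp_apply, ((card_image_comp_eq_iff b f).1 h).eq_iff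
      (Set.mem_range_self _) (Set.mem_range_self _)]
  omega

end GeometricMultiplicity

theorem diagonal_mem_skewHermitian_iff {n : ℕ} {d : Fin n → ℂ} :
    Matrix.diagonal d ∈ SkewHermitian n ↔ ∀ i, star (d i) = -d i := by
  change star (Matrix.diagonal d) = -Matrix.diagonal d ↔ _
  rw [Matrix.star_eq_conjTranspose, Matrix.diagonal_conjTranspose, Matrix.diagonal_neg,
    Matrix.diagonal_eq_diagonal_iff]
  rfl

theorem exists_conjStarAlgAut_diagonal_eq_of_mem_skewHermitian {n : ℕ}
    {A : Matrix (Fin n) (Fin n) ℂ} (hA : A ∈ SkewHermitian n) :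
    ∃ (U : unitary (Matrix (Fin n) (Fin n) ℂ)) (d : Fin n → ℂ),
      Matrix.diagonal d ∈ SkewHermitian n ∧
        Unitary.conjStarAlgAut ℂ _ U (Matrix.diagonal d) = A := by
  have hherm : (-Complex.I • A).IsHermitian := by
    have hstar : star A = -A := hA
    change star (-Complex.I • A) = _
    rw [star_smul, hstar, star_neg, Complex.star_def, Complex.conj_I, neg_neg, smul_neg, neg_smul]
  refine ⟨hherm.eigenvectorUnitary, fun i => Complex.I * hherm.eigenvalues i,
    diagonal_mem_skewHermitian_iff.2 fun i => by simp, ?_⟩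
  have hscale : Matrix.diagonal (fun i => Complex.I * (hherm.eigenvalues i : ℂ)) =
      Complex.I • Matrix.diagonal (RCLike.ofReal ∘ hherm.eigenvalues) := by
    rw [← Matrix.diagonal_smul]
    rfl
  rw [hscale, map_smul, ← hherm.spectral_theorem, smul_smul]
  simp

section EigenvaluePerturbation

variable {𝕜 ι : Type*} [RCLike 𝕜] [Fintype ι] [DecidableEq ι]

section
attribute [local instance] Matrix.frobeniusNormedRing Matrix.frobeniusNormedAlgebra

theorem norm_sub_le_of_mem_eigenspace {B D : Matrix ι ι 𝕜} {μ δ : 𝕜} {v : ι → 𝕜} (hv : v ≠ 0)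
    (hB : v ∈ Module.End.eigenspace (Matrix.toLin' B) μ)
    (hD : v ∈ Module.End.eigenspace (Matrix.toLin' D) δ) :
    ‖μ - δ‖ ≤ ‖B - D‖ * ‖(1 : Matrix ι ι 𝕜)‖ := by
  have : CompleteSpace (Matrix ι ι 𝕜) := FiniteDimensional.complete 𝕜 _
  rw [Module.End.mem_eigenspace_iff] at hB hD
  have hmem : v ∈ Module.End.eigenspace (Matrix.toLin' (B - D)) (μ - δ) := by
    rw [Module.End.mem_eigenspace_iff, map_sub, LinearMap.sub_apply, hB, hD, sub_smul]
  have hspec := (Module.End.hasEigenvalue_of_hasEigenvector ⟨hmem, hv⟩).mem_spectrum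
  rw [Matrix.spectrum_toLin'] at hspec
  exact spectrum.norm_le_norm_mul_of_mem hspec

theorem eventually_eigenvalue_unique_of_common_eigenvector (D : Matrix ι ι 𝕜) :
    ∀ᶠ B in nhds D, ∀ μ δ δ' : 𝕜,
      Module.End.eigenspace (Matrix.toLin' B) μ ⊓ Module.End.eigenspace (Matrix.toLin' D) δ ≠ ⊥ →
      Module.End.eigenspace (Matrix.toLin' B) μ ⊓ Module.End.eigenspace (Matrix.toLin' D) δ' ≠ ⊥ →
      δ = δ' := by
  obtain ⟨C, hC, hsep⟩ :=
    Set.einfsep_pos.1 (Module.End.finite_hasEigenvalue (Matrix.toLin' D)).einfsep_pos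
  have hcont : Continuous fun B : Matrix ι ι 𝕜 =>
      ENNReal.ofReal (2 * (‖B - D‖ * ‖(1 : Matrix ι ι 𝕜)‖)) :=
    ENNReal.continuous_ofReal.comp (by fun_prop)
  filter_upwards [(hcont.tendsto D).eventually_lt_const (u := C) (by simpa using hC)]
    with B hB μ δ δ' hδ hδ'
  obtain ⟨v, ⟨hvB, hvD⟩, hv⟩ := Submodule.exists_mem_ne_zero_of_ne_bot hδ
  obtain ⟨w, ⟨hwB, hwD⟩, hw⟩ := Submodule.exists_mem_ne_zero_of_ne_bot hδ'
  by_contra hne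
  have hfar := hsep δ (Module.End.hasEigenvalue_of_hasEigenvector ⟨hvD, hv⟩) δ'
    (Module.End.hasEigenvalue_of_hasEigenvector ⟨hwD, hw⟩) hne
  have hclose : dist δ δ' ≤ 2 * (‖B - D‖ * ‖(1 : Matrix ι ι 𝕜)‖) := by
    have hv' := norm_sub_le_of_mem_eigenspace hv hvB hvD
    have hw' := norm_sub_le_of_mem_eigenspace hw hwB hwD
    rw [← dist_eq_norm] at hv' hw'
    linarith [dist_triangle_left δ δ' μ]
  rw [edist_dist] at hfar
  exact (hfar.trans (ENNReal.ofReal_le_ofReal hclose)).not_gt hB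

end

theorem eventually_eigenspace_le_of_commute {D : Matrix ι ι 𝕜}
    (hD : ⨆ δ, Module.End.eigenspace (Matrix.toLin' D) δ = ⊤) :
    ∀ᶠ B in nhds D, Commute B D → ∃ f : 𝕜 → 𝕜, ∀ μ,
      Module.End.eigenspace (Matrix.toLin' B) μ ≤
        Module.End.eigenspace (Matrix.toLin' D) (f μ) := by
  filter_upwards [eventually_eigenvalue_unique_of_common_eigenvector D] with B hunique hcomm
  have hmap (μ : 𝕜) : ∀ v ∈ Module.End.eigenspace (Matrix.toLin' B) μ,
      Matrix.toLin' D v ∈ Module.End.eigenspace (Matrix.toLin' B) μ :=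
    Module.End.mapsTo_genEigenspace_of_comm (hcomm.map Matrix.toLinAlgEquiv'.toAlgHom) μ 1
  have hsplit (μ : 𝕜) : Module.End.eigenspace (Matrix.toLin' B) μ =
      ⨆ δ, Module.End.eigenspace (Matrix.toLin' B) μ ⊓
        Module.End.eigenspace (Matrix.toLin' D) δ := by
    rw [← Submodule.inf_iSup_genEigenspace (hmap μ), hD, inf_top_eq]
  have hex (μ : 𝕜) : ∃ δ,
      Module.End.eigenspace (Matrix.toLin' B) μ ≤ Module.End.eigenspace (Matrix.toLin' D) δ := by
    by_cases h : ∃ δ, Module.End.eigenspace (Matrix.toLin' B) μ ⊓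
        Module.End.eigenspace (Matrix.toLin' D) δ ≠ ⊥
    · obtain ⟨δ, hδ⟩ := h
      refine ⟨δ, (hsplit μ).trans_le (iSup_le fun δ' => ?_)⟩
      by_cases hδ' : Module.End.eigenspace (Matrix.toLin' B) μ ⊓
          Module.End.eigenspace (Matrix.toLin' D) δ' = ⊥
      · exact hδ'.trans_le bot_le
      · exact hunique μ δ δ' hδ hδ' ▸ inf_le_right
    · push Not at h
      exact ⟨0, (hsplit μ).trans_le (iSup_le fun δ => (h δ).trans_le bot_le)⟩
  exact Classical.skolem.1 hex

end EigenvaluePerturbation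

theorem conjStarAlgAut_eq_iff_semiconjBy {R A : Type*} [CommSemiring R] [Semiring A] [StarMul A]
    [Algebra R A] {u : unitary A} {x y : A} :
    Unitary.conjStarAlgAut R A u x = y ↔ SemiconjBy (u : A) x y := by
  rw [Unitary.conjStarAlgAut_apply, SemiconjBy]
  constructor
  · rintro rfl
    rw [mul_assoc, Unitary.coe_star_mul_self, mul_one]
  · intro h
    rw [h, mul_assoc, ← Unitary.coe_star, Unitary.coe_mul_star_self, mul_one]

section Diagonal

variable {R ι : Type*} [Fintype ι] [DecidableEq ι]

theorem semiconjBy_diagonal_iff_col_mem_eigenspace [CommRing R] {V M : Matrix ι ι R} {b : ι → R} :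
    SemiconjBy V (Matrix.diagonal b) M ↔
      ∀ j, V.col j ∈ Module.End.eigenspace (Matrix.toLin' M) (b j) := by
  simp only [Module.End.mem_eigenspace_iff, Matrix.toLin'_apply, SemiconjBy, ← Matrix.ext_iff,
    funext_iff, Matrix.mul_diagonal]
  rw [forall_comm]
  refine forall_congr' fun j => forall_congr' fun i => ?_
  rw [eq_comm, mul_comm (V i j)]
  rfl

theorem semiconjBy_diagonal_diagonal_iff [CommRing R] [IsDomain R] {V : Matrix ι ι R}
    {a d : ι → R} :
    SemiconjBy V (Matrix.diagonal a) (Matrix.diagonal d) ↔ ∀ i j, V i j = 0 ∨ a j = d i := by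
  simp only [SemiconjBy, ← Matrix.ext_iff, Matrix.mul_diagonal, Matrix.diagonal_mul]
  refine forall_congr' fun i => forall_congr' fun j => ?_
  rw [mul_comm (d i), mul_eq_mul_left_iff, or_comm]

theorem semiconjBy_diagonal_comp [CommRing R] [IsDomain R] {V : Matrix ι ι R} {a d : ι → R}
    (h : SemiconjBy V (Matrix.diagonal a) (Matrix.diagonal d)) (g : R → R) :
    SemiconjBy V (Matrix.diagonal (g ∘ a)) (Matrix.diagonal (g ∘ d)) :=
  semiconjBy_diagonal_diagonal_iff.2 fun i j =>
    (semiconjBy_diagonal_diagonal_iff.1 h i j).imp_right (congrArg g)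

end Diagonal

theorem eventually_multiplicityCodim_of_commute_diagonal {n : ℕ} (d : Fin n → ℂ) :
    ∀ᶠ B in nhds (Matrix.diagonal d), B ∈ SkewHermitian n → Commute B (Matrix.diagonal d) →
      multiplicityCodim B ≤ multiplicityCodim (Matrix.diagonal d) ∧
      (multiplicityCodim B = multiplicityCodim (Matrix.diagonal d) ↔
        ∃ g : ℂ → ℂ, B = Matrix.diagonal (g ∘ d)) := by
  have htop : ⨆ δ, Module.End.eigenspace (Matrix.toLin' (Matrix.diagonal d)) δ = ⊤ :=
    Matrix.iSup_eigenspace_toLin'_diagonal_eq_top d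
  filter_upwards [eventually_eigenspace_le_of_commute htop] with B hB hskew hcomm
  obtain ⟨f, hf⟩ := hB hcomm
  obtain ⟨V, b, -, hVb⟩ := exists_conjStarAlgAut_diagonal_eq_of_mem_skewHermitian hskew
  have hVd : Unitary.conjStarAlgAut ℂ _ V (Matrix.diagonal (f ∘ b)) = Matrix.diagonal d := by
    rw [conjStarAlgAut_eq_iff_semiconjBy, semiconjBy_diagonal_iff_col_mem_eigenspace] at hVb ⊢
    exact fun j => hf _ (hVb j)
  have hcodimB : multiplicityCodim (Matrix.diagonal b) = multiplicityCodim B := by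
    rw [← hVb, multiplicityCodim_conjStarAlgAut]
  have hcodimd : multiplicityCodim (Matrix.diagonal (f ∘ b)) =
      multiplicityCodim (Matrix.diagonal d) := by
    rw [← hVd, multiplicityCodim_conjStarAlgAut]
  have hle := multiplicityCodim_diagonal_le_comp b f
  have heq := multiplicityCodim_diagonal_eq_comp_iff b f
  rw [hcodimB, hcodimd] at hle heq
  refine ⟨hle, fun h => ?_, ?_⟩
  · refine ⟨Function.invFunOn f (Set.range b), ?_⟩
    have hinv : Function.invFunOn f (Set.range b) ∘ f ∘ b = b :=
      funext fun j => (heq.1 h).leftInvOn_invFunOn (Set.mem_range_self j)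
    have h := semiconjBy_diagonal_comp (conjStarAlgAut_eq_iff_semiconjBy.1 hVd)
      (Function.invFunOn f (Set.range b))
    rw [hinv] at h
    rw [← hVb]
    exact conjStarAlgAut_eq_iff_semiconjBy.2 h
  · rintro ⟨g, rfl⟩
    exact hle.antisymm (multiplicityCodim_diagonal_le_comp d g)

section BlockPart

variable {ι α R : Type*} [DecidableEq α]

/-- The block-diagonal part of a square matrix, for the blocks given by the fibres of `d`. -/
def blockPart [CommSemiring R] (d : ι → α) : Matrix ι ι R →ₗ[R] Matrix ι ι R where
  toFun X := Matrix.of fun i j => if d i = d j then X i j else 0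
  map_add' X Y := by
    ext i j
    simp only [Matrix.of_apply, Matrix.add_apply]
    split_ifs <;> simp
  map_smul' c X := by
    ext i j
    simp

theorem blockPart_apply [CommSemiring R] (d : ι → α) (X : Matrix ι ι R) (i j : ι) :
    blockPart d X i j = if d i = d j then X i j else 0 :=
  rfl

theorem star_blockPart [CommSemiring R] [StarRing R] (d : ι → α) (X : Matrix ι ι R) :
    star (blockPart d X) = blockPart d (star X) := by
  ext i j
  simp only [Matrix.star_apply, blockPart_apply, eq_comm (a := d j), apply_ite star, star_zero]

variable [DecidableEq ι]

theorem commute_blockPart_diagonal {R : Type*} [CommRing R] [IsDomain R] [DecidableEq R]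
    [Fintype ι] (d : ι → R) (X : Matrix ι ι R) : Commute (blockPart d X) (Matrix.diagonal d) := by
  refine semiconjBy_diagonal_diagonal_iff.2 fun i j => ?_
  rcases eq_or_ne (d i) (d j) with h | h
  · exact .inr h.symm
  · exact .inl (if_neg h)

/-- The matrices whose block-diagonal part, for the blocks given by the fibres of `d`, is a scalar
on each block. -/
def scalarBlockSubmodule [CommSemiring R] (d : ι → α) : Submodule R (Matrix ι ι R) :=
  ((Matrix.diagonalLinearMap ι R R).comp (LinearMap.funLeft R R d)).range.comap (blockPart d)

theorem mem_scalarBlockSubmodule [CommSemiring R] {d : ι → α} {X : Matrix ι ι R} :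
    X ∈ scalarBlockSubmodule d ↔ ∃ g : α → R, blockPart d X = Matrix.diagonal (g ∘ d) :=
  exists_congr fun _ => eq_comm

theorem mem_scalarBlockSubmodule_iff_diagonal_add {R : Type*} [CommRing R] [DecidableEq R]
    {d : ι → R} {X : Matrix ι ι R} : X ∈ scalarBlockSubmodule d ↔
      ∃ g : R → R, Matrix.diagonal d + blockPart d X = Matrix.diagonal (g ∘ d) := by
  rw [mem_scalarBlockSubmodule]
  constructor
  · rintro ⟨g, hg⟩
    exact ⟨id + g, by rw [hg, Matrix.diagonal_add]; rfl⟩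
  · rintro ⟨g, hg⟩
    exact ⟨g - id, by rw [← add_sub_cancel_left (Matrix.diagonal d) (blockPart d X), hg,
      Matrix.diagonal_sub]; rfl⟩

theorem star_mem_scalarBlockSubmodule [CommSemiring R] [StarRing R] {d : ι → α} {X : Matrix ι ι R}
    (hX : X ∈ scalarBlockSubmodule d) : star X ∈ scalarBlockSubmodule d := by
  obtain ⟨g, hg⟩ := mem_scalarBlockSubmodule.1 hX
  refine mem_scalarBlockSubmodule.2 ⟨star g, ?_⟩
  rw [← star_blockPart, hg, Matrix.star_eq_conjTranspose, Matrix.diagonal_conjTranspose]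
  rfl

section Parametrization

variable [Fintype ι]

/-- The matrix with the scalars `x.2` on the diagonal blocks given by the fibres of `d` and the
entries `x.1` off these blocks. -/
def ofScalarBlocks [CommSemiring R] (d : ι → α) :
    ({p : ι × ι // d p.1 ≠ d p.2} → R) × (Finset.univ.image d → R) →ₗ[R] Matrix ι ι R where
  toFun x := Matrix.of fun i j =>
    if h : d i = d j then
      Matrix.diagonal (fun i => x.2 ⟨d i, Finset.mem_image_of_mem d (Finset.mem_univ i)⟩) i j
    else x.1 ⟨(i, j), h⟩
  map_add' x y := by
    ext i j
    by_cases h : d i = d j <;> by_cases h' : i = j <;> simp [h, h']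
  map_smul' c x := by
    ext i j
    by_cases h : d i = d j <;> by_cases h' : i = j <;> simp [h, h']

theorem ofScalarBlocks_apply [CommSemiring R] (d : ι → α)
    (x : ({p : ι × ι // d p.1 ≠ d p.2} → R) × (Finset.univ.image d → R)) (i j : ι) :
    ofScalarBlocks d x i j = if h : d i = d j then
      Matrix.diagonal (fun i => x.2 ⟨d i, Finset.mem_image_of_mem d (Finset.mem_univ i)⟩) i j
    else x.1 ⟨(i, j), h⟩ :=
  rfl

theorem ofScalarBlocks_injective [CommSemiring R] (d : ι → α) :
    Function.Injective (ofScalarBlocks (R := R) d) := by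
  intro x y hxy
  refine Prod.ext (funext fun ⟨⟨i, j⟩, hij⟩ => ?_) (funext fun ⟨a, ha⟩ => ?_)
  · simpa [ofScalarBlocks_apply, show d i ≠ d j from hij] using congr($hxy i j)
  · obtain ⟨i, -, rfl⟩ := Finset.mem_image.1 ha
    simpa [ofScalarBlocks_apply] using congr($hxy i i)

theorem range_ofScalarBlocks [CommSemiring R] (d : ι → α) :
    (ofScalarBlocks (R := R) d).range = scalarBlockSubmodule d := by
  ext X
  rw [mem_scalarBlockSubmodule]
  constructor
  · rintro ⟨x, rfl⟩
    refine ⟨fun a => if ha : a ∈ Finset.univ.image d then x.2 ⟨a, ha⟩ else 0, ?_⟩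
    ext i j
    rw [blockPart_apply, ofScalarBlocks_apply]
    by_cases h : d i = d j <;> by_cases h' : i = j <;> simp_all
  · rintro ⟨g, hg⟩
    refine ⟨(fun p => X p.1.1 p.1.2, fun a => g a), ?_⟩
    ext i j
    rw [ofScalarBlocks_apply]
    split_ifs with h
    · exact congr($hg i j).symm.trans (if_pos h)
    · rfl

theorem finrank_scalarBlockSubmodule [CommRing R] [StrongRankCondition R] (d : ι → α) :
    Module.finrank R (scalarBlockSubmodule (R := R) d) + #{p : ι × ι | d p.1 = d p.2} =
      Fintype.card ι ^ 2 + #(Finset.univ.image d) := by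
  have hcard : #{p : ι × ι | d p.1 = d p.2} + #{p : ι × ι | d p.1 ≠ d p.2} =
      Fintype.card ι ^ 2 := by
    rw [Finset.card_filter_add_card_filter_not, Finset.card_univ, Fintype.card_prod, sq]
  rw [← range_ofScalarBlocks, LinearMap.finrank_range_of_inj (ofScalarBlocks_injective d),
    Module.finrank_prod, Module.finrank_fintype_fun_eq_card, Module.finrank_fintype_fun_eq_card,
    Fintype.card_coe, Fintype.card_subtype]
  omega

end Parametrization

end BlockPart

theorem finrank_scalarBlockSubmodule_add_multiplicityCodim {n : ℕ} (d : Fin n → ℂ) :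
    Module.finrank ℂ (scalarBlockSubmodule (R := ℂ) d) + multiplicityCodim (Matrix.diagonal d) =
      n ^ 2 := by
  have hrank := finrank_scalarBlockSubmodule (R := ℂ) d
  have hcodim := multiplicityCodim_diagonal_add_card_image d
  rw [Fintype.card_fin] at hrank
  omega

theorem contDiff_of_contDiff_coe {𝕜 E F : Type*} [NontriviallyNormedField 𝕜]
    [NormedAddCommGroup E] [NormedSpace 𝕜 E] [NormedAddCommGroup F] [NormedSpace 𝕜 F]
    {p : Submodule 𝕜 F} (hp : p.ClosedComplemented) {m : ℕ∞ω} {f : E → p}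
    (hf : ContDiff 𝕜 m fun x => (f x : F)) : ContDiff 𝕜 m f := by
  obtain ⟨π, hπ⟩ := hp
  simpa only [Function.comp_def, hπ] using π.contDiff.comp hf

section Slice

variable {A : Type*} [NormedRing A] [NormedAlgebra ℝ A] [StarRing A] [StarModule ℝ A]

/-- The parametrization of the skew-adjoint elements around `u x u⋆` by `X ↦ v (x + π X) v⋆`, where
`v = u exp (X - π X)`: to first order, the image of `π` is a slice through `u x u⋆` transverse to
the unitary orbit directions `[H, x]` with `H` in the kernel of `π`. -/
noncomputable def unitarySlice (u : unitary A) (x : skewAdjoint.submodule ℝ A)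
    (π : skewAdjoint.submodule ℝ A →L[ℝ] skewAdjoint.submodule ℝ A)
    (X : skewAdjoint.submodule ℝ A) : skewAdjoint.submodule ℝ A :=
  ⟨u * NormedSpace.exp (X - π X : A) * (x + π X : A) * star (u * NormedSpace.exp (X - π X : A)),
    skewAdjoint.conjugate (x + π X).2 _⟩

variable (u : unitary A) (x : skewAdjoint.submodule ℝ A)
  (π : skewAdjoint.submodule ℝ A →L[ℝ] skewAdjoint.submodule ℝ A)

theorem unitarySlice_zero : (unitarySlice u x π 0 : A) = Unitary.conjStarAlgAut ℝ A u x := by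
  simp [unitarySlice, Unitary.conjStarAlgAut_apply]

variable [CompleteSpace A] [ContinuousStar A]

theorem exists_unitarySlice_eq_conjStarAlgAut (X : skewAdjoint.submodule ℝ A) :
    ∃ v : unitary A, (unitarySlice u x π X : A) = Unitary.conjStarAlgAut ℝ A v (x + π X : A) := by
  let _ := NormedAlgebra.restrictScalars ℚ ℝ A
  exact ⟨u * ⟨_, NormedSpace.exp_mem_unitary_of_mem_skewAdjoint (X - π X).2⟩, rfl⟩

theorem contDiff_unitarySlice : ContDiff ℝ ∞ (unitarySlice u x π) := by
  refine contDiff_of_contDiff_coe ⟨skewAdjointPartL ℝ A, fun X =>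
    DFunLike.congr_fun (skewAdjointPart_comp_subtype_skewAdjoint ℝ) X⟩ ?_
  let ι := (skewAdjoint.submodule ℝ A).subtypeL
  have hexp : ContDiff ℝ ∞ (NormedSpace.exp : A → A) :=
    contDiff_iff_contDiffAt.2 fun a => (NormedSpace.exp_analytic (𝕂 := ℝ) a).contDiffAt
  have hv : ContDiff ℝ ∞ fun X => (u : A) * NormedSpace.exp (X - π X : A) :=
    contDiff_const.mul (hexp.comp (ι - ι ∘L π).contDiff)
  exact (hv.mul (contDiff_const.add (ι ∘L π).contDiff)).mul ((starL' ℝ).contDiff.comp hv)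

theorem coe_fderiv_unitarySlice_zero (H : skewAdjoint.submodule ℝ A) :
    (fderiv ℝ (unitarySlice u x π) 0 H : A) =
      Unitary.conjStarAlgAut ℝ A u (π H + ((H - π H : A) * x - x * (H - π H : A))) := by
  let ι := (skewAdjoint.submodule ℝ A).subtypeL
  let κ := ι - ι ∘L π
  have hexp : HasFDerivAt (fun X => NormedSpace.exp (κ X)) κ 0 := by
    have h : HasFDerivAt (NormedSpace.exp : A → A) (1 : A →L[ℝ] A) (κ 0) :=
      (map_zero κ).symm ▸ hasFDerivAt_exp_zero
    exact h.comp 0 κ.hasFDerivAt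
  have hv := hexp.const_mul (u : A)
  have hslice : HasFDerivAt (fun X => (x : A) + ι (π X)) (ι ∘L π) 0 :=
    (ι ∘L π).hasFDerivAt.const_add _
  have hcoe := (ι.hasFDerivAt.comp 0 ((contDiff_unitarySlice u x π).differentiable
    (by simp)).differentiableAt.hasFDerivAt).unique ((hv.mul' hslice).mul' hv.star)
  have hκ : star (κ H) = -κ H := (H - π H).2
  refine (DFunLike.congr_fun hcoe H).trans ?_
  change u * NormedSpace.exp (κ 0) * (x + ι (π 0)) * star (u * κ H) +
    (u * NormedSpace.exp (κ 0) * ι (π H) + u * κ H * (x + ι (π 0))) *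
      star (u * NormedSpace.exp (κ 0)) = u * (ι (π H) + (κ H * x - x * κ H)) * star (u : A)
  simp only [map_zero, NormedSpace.exp_zero, star_mul, star_one, hκ]
  noncomm_ring

end Slice

/-- The block-diagonal part of a skew-Hermitian matrix, for the blocks given by the fibres of `d`,
as a continuous linear map. -/
noncomputable def skewBlockPart {n : ℕ} (d : Fin n → ℂ) : SkewHermitian n →L[ℝ] SkewHermitian n :=
  (((blockPart (R := ℂ) d).restrictScalars ℝ).restrict fun X (hX : star X = -X) =>
    show star (blockPart d X) = -blockPart d X by
      rw [star_blockPart, hX, map_neg]).toContinuousLinearMap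

theorem eventually_multiplicityCodim_diagonal_add_skewBlockPart {n : ℕ} {d : Fin n → ℂ}
    (hd : Matrix.diagonal d ∈ SkewHermitian n) : ∀ᶠ X : SkewHermitian n in nhds 0,
      multiplicityCodim (Matrix.diagonal d + (skewBlockPart d X).1) ≤
        multiplicityCodim (Matrix.diagonal d) ∧
      (multiplicityCodim (Matrix.diagonal d + (skewBlockPart d X).1) =
        multiplicityCodim (Matrix.diagonal d) ↔ X.1 ∈ scalarBlockSubmodule d) := by
  have hcont : Continuous fun X : SkewHermitian n => Matrix.diagonal d + (skewBlockPart d X).1 := by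
    fun_prop
  filter_upwards [(hcont.tendsto' 0 (Matrix.diagonal d) (by simp)).eventually
    (eventually_multiplicityCodim_of_commute_diagonal d)] with X hX
  rw [mem_scalarBlockSubmodule_iff_diagonal_add]
  exact hX (add_mem hd (skewBlockPart d X).2)
    ((Commute.refl _).add_left (commute_blockPart_diagonal d X.1))

section
attribute [local instance] Matrix.frobeniusNormedRing Matrix.frobeniusNormedAlgebra

theorem injective_fderiv_unitarySlice_diagonal {n : ℕ} (U : unitary (Matrix (Fin n) (Fin n) ℂ))
    {d : Fin n → ℂ} (hd : Matrix.diagonal d ∈ SkewHermitian n) :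
    Function.Injective (fderiv ℝ (unitarySlice U ⟨Matrix.diagonal d, hd⟩ (skewBlockPart d)) 0) := by
  have : CompleteSpace (Matrix (Fin n) (Fin n) ℂ) := FiniteDimensional.complete ℝ _
  rw [injective_iff_map_eq_zero]
  intro H hH
  have hslice : blockPart d H.1 + ((H.1 - blockPart d H.1) * Matrix.diagonal d -
      Matrix.diagonal d * (H.1 - blockPart d H.1)) = 0 :=
    EmbeddingLike.map_eq_zero_iff.1 <|
      (coe_fderiv_unitarySlice_zero U ⟨Matrix.diagonal d, hd⟩ (skewBlockPart d) H).symm.trans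
        (congrArg Subtype.val hH)
  ext i j
  have hij := congr($hslice i j)
  rw [Matrix.add_apply, Matrix.sub_apply, Matrix.mul_diagonal, Matrix.diagonal_mul,
    Matrix.sub_apply, blockPart_apply, Matrix.zero_apply] at hij
  change H.1 i j = 0
  split_ifs at hij with h
  · simpa using hij
  · have hprod : (d j - d i) * H.1 i j = 0 := by linear_combination hij
    exact (mul_eq_zero_iff_left (sub_ne_zero.2 (Ne.symm h))).1 hprod

theorem exists_smooth_chart_multiplicityCodim {n : ℕ} (A : SkewHermitian n) :
    ∃ (φ : OpenPartialHomeomorph (SkewHermitian n) (SkewHermitian n))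
      (W : Submodule ℝ (SkewHermitian n)), A ∈ φ.source ∧ ContDiffOn ℝ ∞ φ φ.source ∧
      ContDiffOn ℝ ∞ φ.symm φ.target ∧ Module.finrank ℝ W + multiplicityCodim A.1 = n ^ 2 ∧
      ∀ B ∈ φ.source, multiplicityCodim B.1 ≤ multiplicityCodim A.1 ∧
        (multiplicityCodim B.1 = multiplicityCodim A.1 ↔ φ B ∈ W) := by
  have : CompleteSpace (Matrix (Fin n) (Fin n) ℂ) := FiniteDimensional.complete ℝ _
  obtain ⟨U, d, hd, hA⟩ := exists_conjStarAlgAut_diagonal_eq_of_mem_skewHermitian A.2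
  have hcodim : multiplicityCodim A.1 = multiplicityCodim (Matrix.diagonal d) := by
    rw [← hA, multiplicityCodim_conjStarAlgAut]
  let Φ := unitarySlice U ⟨Matrix.diagonal d, hd⟩ (skewBlockPart d)
  have hΦ : ContDiff ℝ ∞ Φ := contDiff_unitarySlice U ⟨Matrix.diagonal d, hd⟩ (skewBlockPart d)
  have hΦ0 : Φ 0 = A := Subtype.ext ((unitarySlice_zero U ⟨Matrix.diagonal d, hd⟩ _).trans hA)
  let e := (LinearEquiv.ofInjectiveEndo _
    (injective_fderiv_unitarySlice_diagonal U hd)).toContinuousLinearEquiv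
  have he : HasFDerivAt Φ (e : SkewHermitian n →L[ℝ] SkewHermitian n) 0 :=
    (hΦ.differentiable (by simp)).differentiableAt.hasFDerivAt
  obtain ⟨φ, hφA, hφ, hφsymm, hφΦ⟩ := exists_smooth_chart_of_hasFDerivAt_equiv (by simp) hΦ he
    (eventually_multiplicityCodim_diagonal_add_skewBlockPart hd)
  refine ⟨φ, ((scalarBlockSubmodule d).restrictScalars ℝ).comap (SkewHermitian n).subtype,
    hΦ0 ▸ hφA, hφ, hφsymm, ?_, fun B hB => ?_⟩
  · rw [hcodim, finrank_comap_skewAdjoint_subtype fun _ => star_mem_scalarBlockSubmodule,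
      finrank_scalarBlockSubmodule_add_multiplicityCodim]
  · obtain ⟨hmem, hΦB⟩ := hφΦ B hB
    obtain ⟨V, hV⟩ :=
      exists_unitarySlice_eq_conjStarAlgAut U ⟨Matrix.diagonal d, hd⟩ (skewBlockPart d) (φ B)
    have hcodimB : multiplicityCodim B.1 =
        multiplicityCodim (Matrix.diagonal d + (skewBlockPart d (φ B)).1) :=
      (congrArg multiplicityCodim ((congrArg Subtype.val hΦB.symm).trans hV)).trans
        (multiplicityCodim_conjStarAlgAut V _)
    rw [hcodim, hcodimB]
    exact hmem

end

theorem multiplicityCodim_le_sq {n : ℕ} (A : SkewHermitian n) : multiplicityCodim A.1 ≤ n ^ 2 := by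
  obtain ⟨-, W, -, -, -, hW, -⟩ := exists_smooth_chart_multiplicityCodim A
  exact hW ▸ Nat.le_add_left _ _

theorem isSubmanifoldOfCodim_multiplicityCodim_eq {n : ℕ} (A : SkewHermitian n) :
    IsSubmanifoldOfCodim (multiplicityCodim A.1)
      {B : SkewHermitian n | multiplicityCodim B.1 = multiplicityCodim A.1} := by
  refine ⟨⟨A, rfl⟩, n ^ 2 - multiplicityCodim A.1, fun B (hB : _ = _) => ?_, ?_⟩
  · obtain ⟨φ, W, hBφ, hφ, hφsymm, hW, hφW⟩ := exists_smooth_chart_multiplicityCodim B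
    rw [hB] at hW hφW
    exact ⟨φ, W, hBφ, hφ, hφsymm, Nat.eq_sub_of_add_eq hW, fun C hC => (hφW C hC).2⟩
  · rw [finrank_skewHermitian, Nat.sub_add_cancel (multiplicityCodim_le_sq A)]

theorem isOpen_multiplicityCodim_le (n k : ℕ) :
    IsOpen {A : SkewHermitian n | multiplicityCodim A.1 ≤ k} := by
  refine isOpen_iff_mem_nhds.2 fun A hA => ?_
  obtain ⟨φ, _, hAφ, -, -, -, hφ⟩ := exists_smooth_chart_multiplicityCodim A
  filter_upwards [φ.open_source.mem_nhds hAφ] with B hB using (hφ B hB).1.trans hA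

theorem eventually_cofinite_injective_add_smul {ι K V : Type*} [Finite ι] [Ring K]
    [IsDomain K] [AddCommGroup V] [Module K V] [Module.IsTorsionFree K V] (x : ι → V) {y : ι → V}
    (hy : Function.Injective y) :
    ∀ᶠ t : K in Filter.cofinite, Function.Injective fun i => x i + t • y i := by
  have hpair (i j : ι) : ∀ᶠ t : K in Filter.cofinite, x i + t • y i = x j + t • y j → i = j := by
    rcases eq_or_ne i j with hij | hij
    · exact .of_forall fun _ _ => hij
    refine Set.Subsingleton.finite fun s hs t ht => ?_
    simp only [Set.mem_ofPred_eq, Set.mem_compl_iff, Classical.not_imp] at hs ht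
    have hsmul : (s - t) • (y i - y j) = 0 := by
      have h := congr($(hs.1) - $(ht.1))
      rw [add_sub_add_left_eq_sub, add_sub_add_left_eq_sub, ← sub_smul, ← sub_smul] at h
      rw [smul_sub, h, sub_self]
    exact sub_eq_zero.1 ((smul_eq_zero_iff_left (sub_ne_zero.2 (hy.ne hij))).1 hsmul)
  exact (Filter.eventually_all.2 fun i => Filter.eventually_all.2 (hpair i)).mono
    fun t ht i j => ht i j

theorem mem_oneDoubleSkewHermitian_of_eq_conjStarAlgAut {n : ℕ} {A : SkewHermitian n}
    (U : unitary (Matrix (Fin n) (Fin n) ℂ)) {e : Fin n → ℂ} (he : Function.Injective e)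
    {a b : Fin n} (hab : a ≠ b)
    (hA : A.1 = Unitary.conjStarAlgAut ℂ _ U (Matrix.diagonal (e ∘ Function.update id b a))) :
    A ∈ oneDoubleSkewHermitian n := by
  have hmult (μ : ℂ) : geomMult A.1 μ = #{i | e (Function.update id b a i) = μ} := by
    rw [hA, geomMult_conjStarAlgAut, geomMult_diagonal]
    rfl
  refine ⟨e a, ?_, fun ν hν => ?_⟩
  · rw [hmult, ← Finset.card_pair hab]
    congr 1
    ext i
    rw [Finset.mem_filter_univ, he.eq_iff, Function.update_apply, Finset.mem_insert,
      Finset.mem_singleton]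
    grind
  · rw [hmult, Finset.card_le_one]
    intro i hi j hj
    rw [Finset.mem_filter_univ] at hi hj
    grind [he.eq_iff, Function.update_apply]

theorem exists_eventually_add_smul_mem_oneDoubleSkewHermitian {n : ℕ} {A : SkewHermitian n}
    (hA : A ∈ derogatorySkewHermitian n) :
    ∃ K : SkewHermitian n, ∀ᶠ t : ℝ in nhdsWithin 0 {0}ᶜ,
      A + t • K ∈ oneDoubleSkewHermitian n := by
  obtain ⟨U, d, -, hUd⟩ := exists_conjStarAlgAut_diagonal_eq_of_mem_skewHermitian A.2
  obtain ⟨μ, hμ⟩ := hA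
  rw [← hUd, geomMult_conjStarAlgAut, geomMult_diagonal, Finset.one_lt_card] at hμ
  obtain ⟨a, ha, b, hb, hab⟩ := hμ
  rw [Finset.mem_filter_univ] at ha hb
  let σ := Function.update id b a
  have hdσ : d ∘ σ = d := by
    rw [Function.comp_update, Function.comp_id, ha, ← hb, Function.update_eq_self]
  let y : Fin n → ℂ := fun i => (i : ℕ) • Complex.I
  have hy : Function.Injective y := fun i j hij => by simpa [y, Fin.ext_iff] using hij
  have hyσ : Matrix.diagonal (y ∘ σ) ∈ SkewHermitian n :=
    diagonal_mem_skewHermitian_iff.2 fun i => by simp [y]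
  refine ⟨⟨Unitary.conjStarAlgAut ℂ _ U (Matrix.diagonal (y ∘ σ)),
    skewAdjoint.conjugate hyσ U⟩, ?_⟩
  filter_upwards [nhdsNE_le_cofinite 0 (eventually_cofinite_injective_add_smul d hy)] with t ht
  refine mem_oneDoubleSkewHermitian_of_eq_conjStarAlgAut U ht hab ?_
  have hsum : Matrix.diagonal ((fun i => d i + t • y i) ∘ σ) =
      Matrix.diagonal d + (t : ℂ) • Matrix.diagonal (y ∘ σ) := by
    rw [← Matrix.diagonal_smul, Matrix.diagonal_add]
    exact congrArg Matrix.diagonal (funext fun i => congr($hdσ i + t • y (σ i)))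
  rw [hsum, map_add, map_smul, hUd]
  rfl

theorem derogatorySkewHermitian_subset_closure (n : ℕ) :
    derogatorySkewHermitian n ⊆ closure (oneDoubleSkewHermitian n) := by
  intro A hA
  obtain ⟨K, hK⟩ := exists_eventually_add_smul_mem_oneDoubleSkewHermitian hA
  have hcont : Continuous fun t : ℝ => A + t • K := by fun_prop
  exact mem_closure_of_tendsto ((hcont.tendsto' 0 A (by simp)).mono_left nhdsWithin_le_nhds) hK

theorem zero_mem_derogatorySkewHermitian {n : ℕ} (hn : 2 ≤ n) :
    0 ∈ derogatorySkewHermitian n := by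
  refine ⟨0, ?_⟩
  rw [ZeroMemClass.coe_zero, ← Matrix.diagonal_zero, geomMult_diagonal]
  simpa using Nat.lt_of_succ_le hn

theorem nonempty_oneDoubleSkewHermitian {n : ℕ} (hn : 2 ≤ n) :
    (oneDoubleSkewHermitian n).Nonempty :=
  closure_nonempty_iff.1
    ⟨0, derogatorySkewHermitian_subset_closure n (zero_mem_derogatorySkewHermitian hn)⟩

theorem mainTheorem7 (n : ℕ) (hn : 2 ≤ n) :
    Module.finrank ℝ (SkewHermitian n) = n ^ 2 ∧
    IsSubmanifoldOfCodim 3 (oneDoubleSkewHermitian n) ∧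
    (∃ U : Set (SkewHermitian n), IsOpen U ∧
      oneDoubleSkewHermitian n = derogatorySkewHermitian n ∩ U) ∧
    derogatorySkewHermitian n ⊆ closure (oneDoubleSkewHermitian n) ∧
    (∃ (k : ℕ) (S : Fin k → Set (SkewHermitian n)),
      derogatorySkewHermitian n \ oneDoubleSkewHermitian n = ⋃ i, S i ∧
      Pairwise (Function.onFun Disjoint S) ∧
      ∀ i, ∃ c : ℕ, 3 < c ∧ IsSubmanifoldOfCodim c (S i)) := by
  refine ⟨finrank_skewHermitian n, ?_, ⟨_, isOpen_multiplicityCodim_le n 3, ?_⟩,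
    derogatorySkewHermitian_subset_closure n, ?_⟩
  · obtain ⟨A, hA⟩ := nonempty_oneDoubleSkewHermitian hn
    rw [oneDoubleSkewHermitian_eq_setOf] at hA ⊢
    exact (hA : multiplicityCodim A.1 = 3) ▸ isSubmanifoldOfCodim_multiplicityCodim_eq A
  · rw [oneDoubleSkewHermitian_eq_setOf, derogatorySkewHermitian_eq_setOf]
    exact Set.ext fun A => le_antisymm_iff.trans and_comm
  · have hdiff : derogatorySkewHermitian n \ oneDoubleSkewHermitian n =
        (fun A : SkewHermitian n => multiplicityCodim A.1) ⁻¹' Set.Ioi 3 := by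
      rw [oneDoubleSkewHermitian_eq_setOf, derogatorySkewHermitian_eq_setOf]
      exact Set.ext fun A => (lt_iff_le_and_ne' (a := multiplicityCodim A.1) (b := 3)).symm
    obtain ⟨k, S, hS, hdisjoint, hlevel⟩ := exists_fin_partition_preimage_singleton
      (fun A : SkewHermitian n => multiplicityCodim A.1) (t := Set.Ioi 3) <|
      (Set.finite_Iic (n ^ 2)).subset (Set.image_subset_iff.2 fun A _ => multiplicityCodim_le_sq A)
    refine ⟨k, S, hdiff.trans hS, hdisjoint, fun i => ?_⟩
    obtain ⟨A, hA, hSi⟩ := hlevel i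
    exact ⟨_, hA, hSi ▸ isSubmanifoldOfCodim_multiplicityCodim_eq A⟩
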